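/- A \emph{graphical one-sided matching problem with exchange cost} (with integer data) consists of a set $N$ of $n$ agents and a set $A$ of $n$ items; a simple undirected agent graph $(N,\tau)$ with positive integer edge weights $w$; a simple undirected item graph $(A,\lambda)$; valuations $v_i : A \to \mathbb{Z}_{\ge 0}$ and exchange costs $c_i : A \times A \to \mathbb{Z}$ for each $i \in N$. An allocation is a bijection $\pi : N \to A$, and the utility of agent $i$ is $$u_i(\pi) = v_i(\pi(i)) + \sum_{\{j,i\} \in \tau \,:\, \{\pi(j),\pi(i)\} \in \lambda} w(\{j,i\}).$$ A coalitional exchange $(X,\mu)$ is a nonempty set $X \subseteq N$ with a bijection $\mu : X \to X$ without fixed points; it turns $\pi$ into $\pi' = \pi^{(X,\mu)}$ with $\pi'(x) = \pi(\mu(x))$ for $x \in X$ and $\pi'(y) = \pi(y)$ for $y \in N \setminus X$. It is permissible under $\pi$ if $\sum_{x \in X} c_x(\pi(x),\pi'(x)) \ge 0$, and it blocks $\pi$ if it is permissible and $u_x(\pi') - c_x(\pi(x),\pi'(x)) > u_x(\pi)$ for every $x \in X$. The allocation $\pi$ is core-stable if no coalitional exchange blocks it. \textbf{Theorem.} There is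 a polynomial-time algorithm (polynomial in the binary length of the instance) that finds a core-stable allocation for every graphical one-sided matching problem with exchange cost that satisfies at least one of the following two properties: (1) the agent graph is edge-empty, or it is complete and all its edges have the same weight; (2) the item graph is edge-empty or complete. In particular, a core-stable allocation exists for every such problem. Polynomial time is measured on a random access machine with integer memory cells whose primitive operations (reading and writing a cell, addition, subtraction, sign test) take one step each; such machines are polynomially equivalent to Turing machines. -/

import Mathlib

/-! ### Graphical one-sided matching problems with exchange costs -/

/-- A graphical one-sided matching problem with exchange cost, with integer data, on a set `N` of
agents and a set `A` of items.  The agent graph is a simple undirected graph whose edges carry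
positive weights (the values of `weight` off the edge set are never used), the item graph is a
simple undirected graph.  `cost i a b` is what agent `i` pays for parting with `a` and
receiving `b`; it may be negative. -/
structure ExchangeMarket (N A : Type*) where
  agentGraph : SimpleGraph N
  weight : Sym2 N → ℕ
  weight_pos : ∀ e ∈ agentGraph.edgeSet, 0 < weight e
  itemGraph : SimpleGraph A
  value : N → A → ℕ
  cost : N → A → A → ℤ

/-- A coalitional exchange: a nonempty set `members` of agents with a fixed-point-free
bijection of it onto itself. -/
structure CoalitionalExchange (N : Type*) where
  members : Finset N
  nonempty : members.Nonempty
  perm : Equiv.Perm {x // x ∈ members}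
  perm_ne : ∀ x, perm x ≠ x

/-- The allocation after the exchange: a member `x` receives the item `π (perm x)`, every other
agent keeps her item. -/
def CoalitionalExchange.apply {N A : Type*} [DecidableEq N] (E : CoalitionalExchange N)
    (π : N ≃ A) : N ≃ A :=
  (Equiv.Perm.ofSubtype E.perm).trans π

namespace ExchangeMarket

variable {N A : Type*} [Fintype N] [DecidableEq N]

open Classical in
/-- The utility of agent `i` under the allocation `π`: her value for her item, plus the weights of
the edges to those neighbours whose items are adjacent to hers. -/
noncomputable def utility (M : ExchangeMarket N A) (π : N ≃ A) (i : N) : ℤ :=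
  (M.value i (π i) : ℤ) +
    ∑ j : N, if M.agentGraph.Adj j i ∧ M.itemGraph.Adj (π j) (π i)
      then (M.weight s(j, i) : ℤ) else 0

/-- The total cost of the exchange is non-negative. -/
def IsPermissible (M : ExchangeMarket N A) (π : N ≃ A) (E : CoalitionalExchange N) : Prop :=
  0 ≤ ∑ x ∈ E.members, M.cost x (π x) (E.apply π x)

/-- Every member of the coalition strictly gains, after paying her cost. -/
def IsBlocking (M : ExchangeMarket N A) (π : N ≃ A) (E : CoalitionalExchange N) : Prop :=
  ∀ x ∈ E.members,
    M.utility π x < M.utility (E.apply π) x - M.cost x (π x) (E.apply π x)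

/-- No permissible exchange with at most `k` members blocks `π`. -/
def IsKStable (M : ExchangeMarket N A) (k : ℕ) (π : N ≃ A) : Prop :=
  ¬ ∃ E : CoalitionalExchange N,
    E.members.card ≤ k ∧ M.IsPermissible π E ∧ M.IsBlocking π E

/-- Core-stability is `|N|`-stability. -/
def IsCoreStable (M : ExchangeMarket N A) (π : N ≃ A) : Prop :=
  M.IsKStable (Fintype.card N) π

/-- The agent graph is edge-empty, or it is complete and all its edges have the same weight. -/
def AgentsUniform {N A : Type*} (M : ExchangeMarket N A) : Prop :=
  M.agentGraph = ⊥ ∨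
    (M.agentGraph = ⊤ ∧ ∃ c : ℕ, ∀ e ∈ M.agentGraph.edgeSet, M.weight e = c)

/-- The item graph is edge-empty or complete. -/
def ItemsUniform {N A : Type*} (M : ExchangeMarket N A) : Prop :=
  M.itemGraph = ⊥ ∨ M.itemGraph = ⊤

open Classical in
/-- The input sequence that describes an instance with agents and items numbered `0, …, n - 1`:
the number `n`, then, row by row, the matrix of edge weights of the agent graph (`0` where there
is no edge), the adjacency matrix of the item graph, the table of values `(i, a)`, and the table
of costs `(i, a, b)`. -/
noncomputable def encode {n : ℕ} (M : ExchangeMarket (Fin n) (Fin n)) : List ℤ :=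
  (n : ℤ) ::
    ((List.finRange n).flatMap fun i => (List.finRange n).map fun j =>
      if M.agentGraph.Adj i j then (M.weight s(i, j) : ℤ) else 0) ++
    ((List.finRange n).flatMap fun a => (List.finRange n).map fun b =>
      if M.itemGraph.Adj a b then 1 else 0) ++
    ((List.finRange n).flatMap fun i => (List.finRange n).map fun a => (M.value i a : ℤ)) ++
    ((List.finRange n).flatMap fun i => (List.finRange n).flatMap fun a =>
      (List.finRange n).map fun b => M.cost i a b)

end ExchangeMarket

/-! ### Random access machine programs with a step count

Memory cells hold integers and are addressed as cell `i` of array `k`; the array name `k` is fixed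
in the program text (so a program uses finitely many arrays) and the index `i` is computed at run
time.  Every primitive operation takes one step.  The only arithmetic operations are addition and
subtraction, so in each step the binary length of the largest number grows by at most one bit, up
to a constant that depends on the program; hence these programs and multitape Turing machines
simulate each other with a polynomial overhead. -/

namespace RAM

/-- A memory: the content of cell `i` of array `k`. -/
abbrev Memory : Type := ℕ → ℤ → ℤ

/-- Integer expressions: constants, the content of a cell, sums and differences. -/
inductive Expr : Type
  | const (z : ℤ)
  | read (k : ℕ) (i : Expr)
  | add (e f : Expr)
  | sub (e f : Expr)

/-- The value of an expression. -/
def Expr.eval (m : Memory) : Expr → ℤ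
  | .const z => z
  | .read k i => m k (i.eval m)
  | .add e f => e.eval m + f.eval m
  | .sub e f => e.eval m - f.eval m

/-- The number of steps to evaluate an expression: one for each operation in it. -/
def Expr.steps : Expr → ℕ
  | .const _ => 1
  | .read _ i => i.steps + 1
  | .add e f => e.steps + f.steps + 1
  | .sub e f => e.steps + f.steps + 1

/-- Programs.  `write k i e` stores the value of `e` in cell `i` of array `k`; `ifPos e p q` runs
`p` if the value of `e` is positive and `q` otherwise; `whilePos e p` repeats `p` as long as the
value of `e` is positive. -/
inductive Program : Type
  | skip
  | write (k : ℕ) (i e : Expr)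
  | seq (p q : Program)
  | ifPos (e : Expr) (p q : Program)
  | whilePos (e : Expr) (p : Program)

/-- The memory `m` after storing `z` in cell `i` of array `k`. -/
def Memory.store (m : Memory) (k : ℕ) (i z : ℤ) : Memory :=
  Function.update m k (Function.update (m k) i z)

/-- `Run p m m' t`: started in the memory `m`, the program `p` halts after `t` steps with the
memory `m'`. -/
inductive Run : Program → Memory → Memory → ℕ → Prop
  | skip (m : Memory) : Run .skip m m 1
  | write (m : Memory) (k : ℕ) (i e : Expr) :
      Run (.write k i e) m (m.store k (i.eval m) (e.eval m)) (i.steps + e.steps + 1)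
  | seq {p q : Program} {m m' m'' : Memory} {t t' : ℕ} :
      Run p m m' t → Run q m' m'' t' → Run (.seq p q) m m'' (t + t')
  | ifPos_true {e : Expr} {p q : Program} {m m' : Memory} {t : ℕ} :
      0 < e.eval m → Run p m m' t → Run (.ifPos e p q) m m' (e.steps + 1 + t)
  | ifPos_false {e : Expr} {p q : Program} {m m' : Memory} {t : ℕ} :
      ¬ 0 < e.eval m → Run q m m' t → Run (.ifPos e p q) m m' (e.steps + 1 + t)
  | whilePos_true {e : Expr} {p : Program} {m m' m'' : Memory} {t t' : ℕ} :
      0 < e.eval m → Run p m m' t → Run (.whilePos e p) m' m'' t' →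
        Run (.whilePos e p) m m'' (e.steps + 1 + t + t')
  | whilePos_false {e : Expr} {p : Program} {m : Memory} :
      ¬ 0 < e.eval m → Run (.whilePos e p) m m (e.steps + 1)

/-- Programs are deterministic: the final memory and the number of steps are determined by the
program and the initial memory. -/
theorem Run.unique {p : Program} {m m₁ m₂ : Memory} {t₁ t₂ : ℕ}
    (h₁ : Run p m m₁ t₁) (h₂ : Run p m m₂ t₂) : m₁ = m₂ ∧ t₁ = t₂ := by
  induction h₁ generalizing m₂ t₂ with
  | skip m => cases h₂; exact ⟨rfl, rfl⟩
  | write m k i e => cases h₂; exact ⟨rfl, rfl⟩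
  | seq _ _ ih ih' =>
    cases h₂ with
    | seq a b =>
      obtain ⟨rfl, rfl⟩ := ih a
      obtain ⟨rfl, rfl⟩ := ih' b
      exact ⟨rfl, rfl⟩
  | ifPos_true h _ ih =>
    cases h₂ with
    | ifPos_true _ a => obtain ⟨rfl, rfl⟩ := ih a; exact ⟨rfl, rfl⟩
    | ifPos_false h' _ => exact absurd h h'
  | ifPos_false h _ ih =>
    cases h₂ with
    | ifPos_true h' _ => exact absurd h' h
    | ifPos_false _ a => obtain ⟨rfl, rfl⟩ := ih a; exact ⟨rfl, rfl⟩
  | whilePos_true h _ _ ih ih' =>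
    cases h₂ with
    | whilePos_true _ a b =>
      obtain ⟨rfl, rfl⟩ := ih a
      obtain ⟨rfl, rfl⟩ := ih' b
      exact ⟨rfl, rfl⟩
    | whilePos_false h' => exact absurd h h'
  | whilePos_false h =>
    cases h₂ with
    | whilePos_true h' _ _ => exact absurd h' h
    | whilePos_false _ => exact ⟨rfl, rfl⟩

/-- The initial memory: the input sequence stands in cells `0, 1, 2, …` of array `0`; every other
cell holds `0`. -/
def initial (input : List ℤ) : Memory := fun k i =>
  if k = 0 ∧ 0 ≤ i then input.getD i.toNat 0 else 0

/-- The length of an input: the total number of binary digits of its entries, plus one for each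
entry (sign or separator). -/
def inputLength (input : List ℤ) : ℕ :=
  (input.map fun z => Nat.size z.natAbs + 1).sum

/-- In the memory `m`, cells `0, …, n - 1` of array `1` list the items that the allocation `π`
gives to the agents `0, …, n - 1`. -/
def Outputs {n : ℕ} (m : Memory) (π : Fin n ≃ Fin n) : Prop :=
  ∀ i : Fin n, m 1 ((i : ℕ) : ℤ) = ((π i : ℕ) : ℤ)

end RAM

/-!
If the agents or the items are uniform, the network part of an agent's utility is the sum of an
amount that depends only on the agent and an amount that depends only on the item
(`ExchangeMarket.exists_utility_eq`).  A permissible blocking exchange would raise the total utility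
of its members, because the costs add up to something non-negative.  The members permute their
items, so neither amount contributes to the change of the total, and the exchange would raise the
total value `∑ i, v_i (π i)`.  Hence an allocation of maximum total value is core-stable
(`ExchangeMarket.isCoreStable_of_value_max`), and an assignment problem remains to be solved.

It is solved by the Hungarian method.  The program keeps a partial matching of rows (agents) to
columns (items) and potentials that are feasible everywhere and tight on the matching
(`Hungarian.DualMatching`).  To match another row it grows a forest of tight edges
(`Hungarian.Forest`), each time shifting the potentials by the smallest slack between the rows of
the forest and the other columns (`Hungarian.DualMatching.shift`, `Hungarian.Forest.grow`), until an
unmatched column is reached; it then moves the matching along the branch to that column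
(`Hungarian.Augmenting.step`).  A complete matching with tight potentials is optimal by weak duality
(`Hungarian.DualMatching.exists_optimal`).

All loops run a counter from `0` to `n - 1`, where `n` is the first entry of the input, so the
number of steps is bounded by a polynomial in `n` that is read off the program text
(`RAM.LoopProgram.timeBound`).  `RAM.LoopProgram.exists_run` relates such a program to the function
`RAM.LoopProgram.den` on memories, about which the invariants are then proved.  The growth of a
forest needs at most `n` rounds because each round adds a column and an unmatched one exists; an
augmentation needs at most `n` rounds because the ranks stored in the forest decrease along it.
-/

/-! ### Programs with counted loops -/

namespace RAM

/-- Programs all of whose loops are counted: `loop c p` runs `p` for the values `0, …, n - 1` of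
the counter in cell `0` of array `c`, where `n` is the content of cell `0` of array `0`. -/
inductive LoopProgram : Type
  | skip
  | write (k : ℕ) (i e : Expr)
  | seq (p q : LoopProgram)
  | ifPos (e : Expr) (p q : LoopProgram)
  | loop (c : ℕ) (p : LoopProgram)

namespace LoopProgram

/-- The translation into programs with `while` loops. -/
def toProgram : LoopProgram → Program
  | skip => .skip
  | write k i e => .write k i e
  | seq p q => .seq p.toProgram q.toProgram
  | ifPos e p q => .ifPos e p.toProgram q.toProgram
  | loop c p => .seq (.write c (.const 0) (.const 0))
      (.whilePos (.sub (.read 0 (.const 0)) (.read c (.const 0)))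
        (.seq p.toProgram
          (.write c (.const 0) (.add (.read c (.const 0)) (.const 1)))))

/-- The memory after `r` rounds of a loop with counter `c` and body `f`. -/
def rounds (c : ℕ) (f : Memory → Memory) (m : Memory) : ℕ → Memory
  | 0 => m.store c 0 0
  | r + 1 => (f (rounds c f m r)).store c 0 ((r : ℤ) + 1)

/-- The final memory, when every loop makes `n` rounds. -/
def den (n : ℕ) : LoopProgram → Memory → Memory
  | skip, m => m
  | write k i e, m => m.store k (i.eval m) (e.eval m)
  | seq p q, m => q.den n (p.den n m)
  | ifPos e p q, m => if 0 < e.eval m then p.den n m else q.den n m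
  | loop c p, m => rounds c (p.den n) m n

/-- The arrays that a program may write to, loop counters included. -/
def writes : LoopProgram → List ℕ
  | skip => []
  | write k _ _ => [k]
  | seq p q => p.writes ++ q.writes
  | ifPos _ p q => p.writes ++ q.writes
  | loop c p => c :: p.writes

/-- No loop body writes to the counter of its loop or to array `0`, which holds the number of
rounds. -/
def WellFormed : LoopProgram → Prop
  | skip => True
  | write _ _ _ => True
  | seq p q => p.WellFormed ∧ q.WellFormed
  | ifPos _ p q => p.WellFormed ∧ q.WellFormed
  | loop c p => p.WellFormed ∧ c ≠ 0 ∧ c ∉ p.writes ∧ 0 ∉ p.writes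

/-- A bound on the number of steps, as a polynomial in the number of rounds of the loops. -/
noncomputable def timeBound : LoopProgram → Polynomial ℕ
  | skip => 1
  | write _ i e => .C (i.steps + e.steps + 1)
  | seq p q => p.timeBound + q.timeBound
  | ifPos e p q => .C (e.steps + 1) + p.timeBound + q.timeBound
  | loop _ p => .C 9 + .X * (p.timeBound + .C 12)

end LoopProgram

@[simp]
theorem Memory.store_same (m : Memory) (k : ℕ) (i z : ℤ) :
    m.store k i z k = Function.update (m k) i z := by
  simp [Memory.store]

@[simp]
theorem Memory.store_ne (m : Memory) {k k' : ℕ} (i z : ℤ) (h : k' ≠ k) :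
    m.store k i z k' = m k' := by
  simp [Memory.store, h]

namespace LoopProgram

theorem den_ifPos_pos {n : ℕ} {e : Expr} {p q : LoopProgram} {m : Memory} (h : 0 < e.eval m) :
    (ifPos e p q).den n m = p.den n m := if_pos h

theorem den_ifPos_neg {n : ℕ} {e : Expr} {p q : LoopProgram} {m : Memory} (h : ¬ 0 < e.eval m) :
    (ifPos e p q).den n m = q.den n m := if_neg h

/-- A program leaves the arrays that it does not write to as they are. -/
theorem den_frame (n : ℕ) (p : LoopProgram) {k : ℕ} (m : Memory) (hk : k ∉ p.writes) :
    p.den n m k = m k := by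
  induction p generalizing m with
  | skip => rfl
  | write k' i e =>
    simp only [writes, List.mem_singleton] at hk
    simp [den, hk]
  | seq p q hp hq =>
    simp only [writes, List.mem_append, not_or] at hk
    simp [den, hp _ hk.1, hq _ hk.2]
  | ifPos e p q hp hq =>
    simp only [writes, List.mem_append, not_or] at hk
    simp only [den]
    split_ifs
    · exact hp _ hk.1
    · exact hq _ hk.2
  | loop c p hp =>
    simp only [writes, List.mem_cons, not_or] at hk
    simp only [den]
    generalize n = N at hp ⊢
    suffices ∀ r : ℕ, rounds c (p.den N) m r k = m k from this N
    intro r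
    induction r with
    | zero => simp [rounds, hk.1]
    | succ r ih => simpa [rounds, hk.1, hp _ hk.2] using ih

/-- The invariant rule for counted loops. -/
theorem den_loop {n : ℕ} {c : ℕ} {p : LoopProgram} (I : ℕ → Memory → Prop) {m : Memory}
    (h0 : I 0 (m.store c 0 0))
    (hs : ∀ i < n, ∀ m' : Memory, m' c 0 = (i : ℤ) → I i m' →
      I (i + 1) ((p.den n m').store c 0 ((i : ℤ) + 1))) :
    I n ((loop c p).den n m) := by
  simp only [den]
  suffices ∀ r ≤ n, rounds c (p.den n) m r c 0 = (r : ℤ) ∧ I r (rounds c (p.den n) m r) from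
    (this n le_rfl).2
  intro r hr
  induction r with
  | zero => exact ⟨by simp [rounds], h0⟩
  | succ r ih =>
    obtain ⟨h1, h2⟩ := ih (by omega)
    exact ⟨by simp [rounds], hs r (by omega) _ h1 h2⟩

/-- A well-formed program halts in the memory given by `den`, within its time bound. -/
theorem exists_run {n : ℕ} {p : LoopProgram} (hp : p.WellFormed) (h0 : 0 ∉ p.writes)
    {m : Memory} (hm : m 0 0 = (n : ℤ)) :
    ∃ t ≤ p.timeBound.eval n, Run p.toProgram m (p.den n m) t := by
  induction p generalizing m with
  | skip => exact ⟨1, by simp [timeBound], .skip m⟩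
  | write k i e => exact ⟨_, by simp [timeBound], .write m k i e⟩
  | seq p q ihp ihq =>
    simp only [writes, List.mem_append, not_or] at h0
    obtain ⟨t, ht, h⟩ := ihp hp.1 h0.1 hm
    obtain ⟨t', ht', h'⟩ := ihq hp.2 h0.2 (m := p.den n m) (by rw [den_frame n p m h0.1, hm])
    exact ⟨t + t', by simp only [timeBound, Polynomial.eval_add]; omega, .seq h h'⟩
  | ifPos e p q ihp ihq =>
    simp only [writes, List.mem_append, not_or] at h0
    simp only [den, timeBound, Polynomial.eval_add, Polynomial.eval_C]
    split_ifs with he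
    · obtain ⟨t, ht, h⟩ := ihp hp.1 h0.1 hm
      exact ⟨_, by omega, .ifPos_true he h⟩
    · obtain ⟨t, ht, h⟩ := ihq hp.2 h0.2 hm
      exact ⟨_, by omega, .ifPos_false he h⟩
  | loop c p ih =>
    obtain ⟨hp, hc0, hc, hz⟩ := hp
    set B := p.timeBound.eval n with hB
    set f := rounds c (p.den n) m with hf
    have hfc : ∀ r, f r c 0 = (r : ℤ) := fun r => by cases r <;> simp [hf, rounds]
    have hf0 : ∀ r, f r 0 0 = (n : ℤ) := fun r => by
      induction r with
      | zero => simp [hf, rounds, hc0.symm, hm]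
      | succ r ihr => simpa [hf, rounds, hc0.symm, den_frame n p _ hz] using ihr
    have key : ∀ d r, r + d = n → ∃ t ≤ d * (B + 12) + 6,
        Run (.whilePos (.sub (.read 0 (.const 0)) (.read c (.const 0)))
          (.seq p.toProgram (.write c (.const 0) (.add (.read c (.const 0)) (.const 1)))))
          (f r) (f n) t := by
      intro d
      induction d with
      | zero =>
        rintro r rfl
        refine ⟨_, ?_, .whilePos_false ?_⟩
        · simp [Expr.steps]
        · simp [Expr.eval, hfc, hf0]
      | succ d ihd =>
        intro r hr
        obtain ⟨t, ht, h⟩ := ih hp hz (hf0 r)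
        obtain ⟨t', ht', h'⟩ := ihd (r + 1) (by omega)
        have hw := Run.write (p.den n (f r)) c (.const 0) (.add (.read c (.const 0)) (.const 1))
        have hfr : (p.den n (f r)).store c 0 ((r : ℤ) + 1) = f (r + 1) := rfl
        simp only [Expr.eval, den_frame n p _ hc, hfc, hfr] at hw
        refine ⟨_, ?_, .whilePos_true ?_ (.seq h hw) h'⟩
        · simp only [Expr.steps]
          have : (d + 1) * (B + 12) = d * (B + 12) + (B + 12) := by ring
          omega
        · simp only [Expr.eval, hfc, hf0]; omega
    obtain ⟨t, ht, h⟩ := key n 0 (by omega)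
    refine ⟨_, ?_, .seq (.write m c (.const 0) (.const 0)) h⟩
    simp only [timeBound, Polynomial.eval_add, Polynomial.eval_C, Polynomial.eval_mul,
      Polynomial.eval_X, Expr.steps, ← hB]
    omega

end LoopProgram

end RAM

/-! ### The primal-dual invariants -/

namespace Hungarian

/-- A partial matching of the rows and the columns `0, …, n - 1` together with potentials for a
weight matrix `w`.  The rows `0, …, b - 1` are matched, `X i` is the column matched to row `i` and
`M j` the row matched to column `j` (negative if there is none); `u` and `p` are potentials of the
rows and of the columns, feasible everywhere and tight on matched pairs. -/
structure DualMatching (n b : ℤ) (w : ℤ → ℤ → ℤ) (X M u p : ℤ → ℤ) : Prop where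
  feasible : ∀ i j, 0 ≤ i → i < n → 0 ≤ j → j < n → w i j ≤ u i + p j
  tight : ∀ i, 0 ≤ i → i < n → 0 ≤ X i → w i (X i) = u i + p (X i)
  lt_row : ∀ i, 0 ≤ i → i < n → X i < n ∧ -1 ≤ X i
  lt_col : ∀ j, 0 ≤ j → j < n → M j < n ∧ -1 ≤ M j
  matched : ∀ i, 0 ≤ i → i < n → (0 ≤ X i ↔ i < b)
  inverse : ∀ i j, 0 ≤ i → i < n → 0 ≤ j → j < n → (M j = i ↔ X i = j)

/-- An alternating forest of tight edges that grows from the unmatched row `b`.  Row `i` belongs to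
it if `T i` is positive, column `j` if `S j` is positive; these numbers increase along the
branches.  Column `j` hangs from the row `way j`, and a matched row hangs from its column.  After
`t` rounds either `t` columns have been added, all of them matched, and `h` is negative, or `h` is
an unmatched column of the forest. -/
structure Forest (n b t : ℤ) (w : ℤ → ℤ → ℤ) (X M u p T S way : ℤ → ℤ) (h : ℤ) : Prop where
  root : T b = 1
  row : ∀ i, 0 ≤ i → i < n → 0 < T i → T i ≤ t + 1 ∧ (i = b ∨ 0 ≤ X i ∧ S (X i) = T i)
  col : ∀ j, 0 ≤ j → j < n → 0 < S j → S j ≤ t + 1 ∧ 0 ≤ way j ∧ way j < n ∧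
    0 < T (way j) ∧ T (way j) < S j ∧ w (way j) j = u (way j) + p j
  col_row : ∀ j, 0 ≤ j → j < n → 0 < S j → 0 ≤ M j → T (M j) = S j
  searching : h < 0 → (∀ j, 0 ≤ j → j < n → 0 < S j → 0 ≤ M j) ∧
    (((Finset.Ico 0 n).filter fun j => 0 < S j).card : ℤ) = t
  found : 0 ≤ h → h < n ∧ 0 < S h ∧ M h < 0

variable {n b t : ℤ} {w : ℤ → ℤ → ℤ} {X M u p T S way : ℤ → ℤ} {h : ℤ}

/-- As long as some row is unmatched, so is some column. -/
theorem DualMatching.exists_free (H : DualMatching n b w X M u p) (hb0 : 0 ≤ b) (hb : b < n) :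
    ∃ j, 0 ≤ j ∧ j < n ∧ M j < 0 := by
  by_contra! hM
  have hmap : ∀ j ∈ Finset.Ico 0 n, M j ∈ Finset.Ico 0 b := by
    intro j hj
    rw [Finset.mem_Ico] at hj ⊢
    have h1 := hM j hj.1 hj.2
    have h2 := H.lt_col j hj.1 hj.2
    have h3 := (H.inverse (M j) j h1 h2.1 hj.1 hj.2).1 rfl
    exact ⟨h1, (H.matched _ h1 h2.1).1 (by omega)⟩
  have hinj : Set.InjOn M (Finset.Ico 0 n : Finset ℤ) := by
    intro j hj k hk hjk
    simp only [Finset.coe_Ico, Set.mem_Ico] at hj hk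
    have h1 := hM j hj.1 hj.2
    have h2 := H.lt_col j hj.1 hj.2
    have h3 := (H.inverse (M j) j h1 h2.1 hj.1 hj.2).1 rfl
    have h4 := (H.inverse (M j) k h1 h2.1 hk.1 hk.2).1 hjk.symm
    omega
  have := Finset.card_le_card_of_injOn M hmap hinj
  simp only [Int.card_Ico] at this
  omega

/-- While the search goes on, fewer than `n` rounds have been made. -/
theorem Forest.lt (F : Forest n b t w X M u p T S way h) (H : DualMatching n b w X M u p)
    (hb0 : 0 ≤ b) (hb : b < n) (hh : h < 0) : t < n := by
  obtain ⟨j, hj0, hjn, hj⟩ := H.exists_free hb0 hb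
  obtain ⟨h1, h2⟩ := F.searching hh
  have hlt : ((Finset.Ico 0 n).filter fun j => 0 < S j) ⊂ Finset.Ico 0 n := by
    rw [Finset.filter_ssubset]
    refine ⟨j, by simp [hj0, hjn], fun hS => ?_⟩
    have := h1 j hj0 hjn hS
    omega
  have := Finset.card_lt_card hlt
  simp only [Int.card_Ico] at this
  omega

/-- The forest consisting of the root. -/
theorem Forest.init (hb0 : 0 ≤ b) (hT : ∀ i, 0 ≤ i → i < n → i ≠ b → T i = 0) (hTb : T b = 1)
    (hS : ∀ j, 0 ≤ j → j < n → S j = 0) : Forest n b 0 w X M u p T S way (-1) where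
  root := hTb
  row i h0 hn hi := by
    by_cases hib : i = b
    · subst hib; omega
    · have := hT i h0 hn hib; omega
  col j h0 hn hj := by have := hS j h0 hn; omega
  col_row j h0 hn hj := by have := hS j h0 hn; omega
  searching _ := by
    refine ⟨fun j h0 hn hj => by have := hS j h0 hn; omega, ?_⟩
    rw [Finset.filter_eq_empty_iff.2]
    · simp
    · intro j hj
      rw [Finset.mem_Ico] at hj
      rw [hS j hj.1 hj.2]; simp
  found h := by omega

section Grow

variable {i₁ j₁ δ : ℤ} {u' p' : ℤ → ℤ}

/-- Lowering the potentials of the rows of the forest and raising those of its columns by the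
smallest slack between its rows and the other columns keeps the potentials feasible, and tight on
matched pairs. -/
theorem DualMatching.shift (H : DualMatching n b w X M u p)
    (F : Forest n b t w X M u p T S way h)
    (hmin : ∀ i j, 0 ≤ i → i < n → 0 ≤ j → j < n → 0 < T i → ¬ 0 < S j → δ ≤ u i + p j - w i j)
    (hδ : 0 ≤ δ)
    (hu : ∀ i, 0 ≤ i → i < n → u' i = if 0 < T i then u i - δ else u i)
    (hp : ∀ j, 0 ≤ j → j < n → p' j = if 0 < S j then p j + δ else p j) :
    DualMatching n b w X M u' p' where
  feasible i j hi0 hin hj0 hjn := by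
    rw [hu i hi0 hin, hp j hj0 hjn]
    have h1 := H.feasible i j hi0 hin hj0 hjn
    have h2 := hmin i j hi0 hin hj0 hjn
    split_ifs with hT hS hS
    · omega
    · have := h2 hT hS; omega
    · omega
    · omega
  tight i hi0 hin hX := by
    have hXn := (H.lt_row i hi0 hin).1
    rw [hu i hi0 hin, hp _ hX hXn, H.tight i hi0 hin hX]
    have hM := (H.inverse i (X i) hi0 hin hX hXn).2 rfl
    have h1 := F.row i hi0 hin
    have h2 := F.col_row (X i) hX hXn
    have h3 := H.matched i hi0 hin
    rw [hM] at h2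
    split_ifs with hT hS hS
    · omega
    · have := h1 hT; omega
    · have := h2 hS hi0; omega
    · omega
  lt_row := H.lt_row
  lt_col := H.lt_col
  matched := H.matched
  inverse := H.inverse

/-- The growth step: column `j₁` with the smallest slack joins the forest, and so does its row if
it is matched; otherwise the search ends at `j₁`. -/
theorem Forest.grow {T' S' way' : ℤ → ℤ} {h' : ℤ} (H : DualMatching n b w X M u p)
    (F : Forest n b t w X M u p T S way h) (hh : h < 0) (ht : 0 ≤ t)
    (hb0 : 0 ≤ b) (hb : b < n)
    (hi0 : 0 ≤ i₁) (hin : i₁ < n) (hj0 : 0 ≤ j₁) (hjn : j₁ < n)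
    (hT : 0 < T i₁) (hS : ¬ 0 < S j₁) (hδ : δ = u i₁ + p j₁ - w i₁ j₁)
    (hu : ∀ i, 0 ≤ i → i < n → u' i = if 0 < T i then u i - δ else u i)
    (hp : ∀ j, 0 ≤ j → j < n → p' j = if 0 < S j then p j + δ else p j)
    (hS' : S' = Function.update S j₁ (t + 2)) (hway : way' = Function.update way j₁ i₁)
    (hT' : T' = if 0 ≤ M j₁ then Function.update T (M j₁) (t + 2) else T)
    (hh' : h' = if 0 ≤ M j₁ then h else j₁) :
    Forest n b (t + 1) w X M u' p' T' S' way' h' where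
  root := by
    have h1 := F.root
    have h2 := H.matched b hb0 hb
    have h3 := H.inverse b j₁ hb0 hb hj0 hjn
    have : b ≠ M j₁ := by intro e; have := h3.1 e.symm; omega
    rw [hT']; split_ifs <;> simp [this, h1]
  row i hi0 hin hTi := by
    have h1 := F.row i hi0 hin
    have h2 := H.inverse i j₁ hi0 hin hj0 hjn
    have h3 := H.matched i hi0 hin
    subst hT' hS'
    by_cases hM : 0 ≤ M j₁ <;> simp only [hM, if_true, if_false] at hTi ⊢
    · by_cases hi : i = M j₁
      · have := h2.1 hi.symm
        subst hi
        simp [this, hj0, add_assoc]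
      · have hX : X i ≠ j₁ := fun e => hi (h2.2 e).symm
        simp only [Function.update_of_ne hi, Function.update_of_ne hX] at hTi ⊢
        have := h1 hTi
        exact ⟨by omega, this.2⟩
    · have hX : X i ≠ j₁ := fun e => by have := (h2.2 e); omega
      simp only [Function.update_of_ne hX]
      have := h1 hTi
      exact ⟨by omega, this.2⟩
  col j hj0' hjn' hSj := by
    have hTM : 0 ≤ M j₁ → T (M j₁) ≤ 0 := by
      intro hM
      by_contra! hpos
      have h1 := F.row (M j₁) hM (H.lt_col j₁ hj0 hjn).1 hpos
      have h2 := (H.inverse (M j₁) j₁ hM (H.lt_col j₁ hj0 hjn).1 hj0 hjn).1 rfl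
      have h3 := H.matched (M j₁) hM (H.lt_col j₁ hj0 hjn).1
      rw [h2] at h1 h3
      omega
    have hTT : ∀ i, 0 < T i → T' i = T i := by
      intro i hi
      rw [hT']
      split_ifs with hM
      · have : i ≠ M j₁ := by rintro rfl; have := hTM hM; omega
        rw [Function.update_of_ne this]
      · rfl
    by_cases hj : j = j₁
    · subst hj
      simp only [hS', hway, Function.update_self]
      rw [hTT i₁ hT, hu i₁ hi0 hin, if_pos hT, hp j hj0 hjn, if_neg hS]
      have := F.row i₁ hi0 hin hT
      omega
    · simp only [hS', hway, Function.update_of_ne hj] at hSj ⊢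
      obtain ⟨h1, h2, h3, h4, h5, h6⟩ := F.col j hj0' hjn' hSj
      rw [hTT _ h4, hu _ h2 h3, if_pos h4, hp j hj0' hjn', if_pos hSj]
      omega
  col_row j hj0' hjn' hSj hM := by
    by_cases hj : j = j₁
    · subst hj; simp [hT', hS', hM]
    · have hMj : 0 ≤ M j₁ → M j ≠ M j₁ := by
        intro hM1 e
        have h2 := (H.inverse (M j₁) j₁ hM1 (H.lt_col j₁ hj0 hjn).1 hj0 hjn).1 rfl
        have h3 := (H.inverse (M j₁) j hM1 (H.lt_col j₁ hj0 hjn).1 hj0' hjn').1 e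
        omega
      simp only [hS', Function.update_of_ne hj] at hSj ⊢
      rw [← F.col_row j hj0' hjn' hSj hM, hT']
      split_ifs with hM1
      · rw [Function.update_of_ne (hMj hM1)]
      · rfl
  searching hh1 := by
    rw [hh'] at hh1
    have hM : 0 ≤ M j₁ := by
      by_contra hM
      rw [if_neg hM] at hh1
      omega
    obtain ⟨h1, h2⟩ := F.searching hh
    constructor
    · intro j hj0' hjn' hSj
      by_cases hj : j = j₁
      · subst hj; exact hM
      · rw [hS', Function.update_of_ne hj] at hSj
        exact h1 j hj0' hjn' hSj
    · have : ((Finset.Ico 0 n).filter fun j => 0 < S' j) =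
          insert j₁ ((Finset.Ico 0 n).filter fun j => 0 < S j) := by
        ext j
        simp only [Finset.mem_filter, Finset.mem_Ico, Finset.mem_insert, hS']
        by_cases hj : j = j₁
        · subst hj; simp [hj0, hjn]; omega
        · simp [hj]
      rw [this, Finset.card_insert_of_notMem (by simp [hS])]
      push_cast; omega
  found hh1 := by
    rw [hh'] at hh1 ⊢
    split_ifs at hh1 ⊢ with hM
    · omega
    · simp [hS', hjn]; omega

end Grow

/-- The state in the middle of an augmentation.  Column `h`, if `h` is not negative, is a hole: no
row is matched to it, whatever stale row `M h` records, and its rank in the forest is at most `r`.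
The rows below `b` are matched, and row `b` is matched once there is no hole.  The forest still
describes the old matching; by the last part of `hole`, it agrees with the current one on the rows
of rank below that of the hole. -/
structure Augmenting (n b r : ℤ) (w : ℤ → ℤ → ℤ) (X M u p T S way : ℤ → ℤ) (h : ℤ) : Prop where
  feasible : ∀ i j, 0 ≤ i → i < n → 0 ≤ j → j < n → w i j ≤ u i + p j
  tight : ∀ i, 0 ≤ i → i < n → 0 ≤ X i → w i (X i) = u i + p (X i)
  lt_row : ∀ i, 0 ≤ i → i < n → X i < n ∧ -1 ≤ X i
  lt_col : ∀ j, 0 ≤ j → j < n → M j < n ∧ -1 ≤ M j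
  matched : ∀ i, 0 ≤ i → i < n → (0 ≤ X i ↔ i < b ∨ i = b ∧ h < 0)
  inverse : ∀ i j, 0 ≤ i → i < n → 0 ≤ j → j < n → j ≠ h → (M j = i ↔ X i = j)
  hole : 0 ≤ h → (h < n ∧ 0 < S h ∧ S h ≤ r) ∧ (∀ i, 0 ≤ i → i < n → X i ≠ h) ∧
    (∀ i, 0 ≤ i → i < n → 0 < T i → T i < S h → i = b ∨ 0 ≤ X i ∧ S (X i) = T i)
  col : ∀ j, 0 ≤ j → j < n → 0 < S j → 0 ≤ way j ∧ way j < n ∧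
    0 < T (way j) ∧ T (way j) < S j ∧ w (way j) j = u (way j) + p j

theorem Augmenting.init (H : DualMatching n b w X M u p) (F : Forest n b t w X M u p T S way h)
    (hh : 0 ≤ h) : Augmenting n b (t + 1) w X M u p T S way h where
  feasible := H.feasible
  tight := H.tight
  lt_row := H.lt_row
  lt_col := H.lt_col
  matched i h0 hn := by rw [H.matched i h0 hn]; omega
  inverse i j hi0 hin hj0 hjn _ := H.inverse i j hi0 hin hj0 hjn
  hole _ := by
    obtain ⟨h1, h2, h3⟩ := F.found hh
    refine ⟨⟨h1, h2, (F.col h hh h1 h2).1⟩, fun i hi0 hin e => ?_,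
      fun i hi0 hin hT _ => (F.row i hi0 hin hT).2⟩
    have := (H.inverse i h hi0 hin hh h1).2 e
    omega
  col j hj0 hjn hS := (F.col j hj0 hjn hS).2

/-- The hole `h` is filled with its parent row `way h`, along a tight edge; the column that this row
leaves becomes the hole, or the augmentation ends if the row was the root. -/
theorem Augmenting.step {r : ℤ} {X' M' : ℤ → ℤ} (G : Augmenting n b r w X M u p T S way h)
    (hh : 0 ≤ h)
    (hX' : X' = Function.update X (way h) h) (hM' : M' = Function.update M h (way h)) :
    Augmenting n b (r - 1) w X' M' u p T S way (X (way h)) := by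
  obtain ⟨⟨h1, h2, h3⟩, h4, h5⟩ := G.hole hh
  obtain ⟨c1, c2, c3, c4, c5⟩ := G.col h hh h1 h2
  have hk := G.lt_row _ c1 c2
  have hkh := h4 _ c1 c2
  have hm := G.matched _ c1 c2
  have hr := h5 _ c1 c2 c3 c4
  subst hX' hM'
  constructor
  · exact G.feasible
  · intro i hi0 hin
    by_cases hi : i = way h
    · subst hi; simpa using fun _ => c5
    · simpa [hi] using G.tight i hi0 hin
  · intro i hi0 hin
    by_cases hi : i = way h
    · subst hi; simp; omega
    · simpa [hi] using G.lt_row i hi0 hin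
  · intro j hj0 hjn
    by_cases hj : j = h
    · subst hj; simp; omega
    · simpa [hj] using G.lt_col j hj0 hjn
  · intro i hi0 hin
    have := G.matched i hi0 hin
    by_cases hi : i = way h
    · subst hi; simp only [Function.update_self]; omega
    · simp only [Function.update_of_ne hi]; omega
  · intro i j hi0 hin hj0 hjn hj
    by_cases hjh : j = h
    · subst hjh
      by_cases hi : i = way j
      · simp [hi]
      · simpa [hi, eq_comm] using h4 i hi0 hin
    · have := G.inverse i j hi0 hin hj0 hjn hjh
      by_cases hi : i = way h
      · subst hi; simp only [Function.update_self, Function.update_of_ne hjh]; omega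
      · simpa [hi, hjh] using this
  · intro hk0
    have hSk : S (X (way h)) = T (way h) := by omega
    refine ⟨by omega, fun i hi0 hin => ?_, fun i hi0 hin hT1 hT2 => ?_⟩
    · by_cases hi : i = way h
      · subst hi; simpa using hkh.symm
      · have e1 := G.inverse i _ hi0 hin hk0 hk.1 hkh
        have e2 := G.inverse (way h) _ c1 c2 hk0 hk.1 hkh
        simp only [Function.update_of_ne hi]; omega
    · have hi : i ≠ way h := by rintro rfl; omega
      simpa [hi] using h5 i hi0 hin hT1 (by omega)
  · exact G.col

theorem Augmenting.dualMatching {r : ℤ} (G : Augmenting n b r w X M u p T S way h) (hh : h < 0) :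
    DualMatching n (b + 1) w X M u p where
  feasible := G.feasible
  tight := G.tight
  lt_row := G.lt_row
  lt_col := G.lt_col
  matched i h0 hn := by rw [G.matched i h0 hn]; omega
  inverse i j hi0 hin hj0 hjn := G.inverse i j hi0 hin hj0 hjn (by omega)

/-- A complete matching with feasible potentials that are tight on it has maximum weight, by weak
duality. -/
theorem DualMatching.exists_optimal {n : ℕ} (H : DualMatching n n w X M u p) :
    ∃ π : Fin n ≃ Fin n, (∀ i : Fin n, X ((i : ℕ) : ℤ) = ((π i : ℕ) : ℤ)) ∧
      ∀ σ : Fin n ≃ Fin n, ∑ i : Fin n, w (i : ℕ) (σ i : ℕ) ≤ ∑ i : Fin n, w (i : ℕ) (π i : ℕ) := by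
  have hX : ∀ i : Fin n, ∃ j : Fin n, X ((i : ℕ) : ℤ) = ((j : ℕ) : ℤ) := by
    intro i
    have h1 := H.lt_row (i : ℕ) (by omega) (by omega)
    have h2 := (H.matched (i : ℕ) (by omega) (by omega)).2 (by omega)
    exact ⟨⟨(X (i : ℕ)).toNat, by omega⟩, by simp; omega⟩
  choose f hf using hX
  have hinj : Function.Injective f := by
    intro i k hik
    have h1 := (H.inverse (i : ℕ) (f i : ℕ) (by omega) (by omega) (by omega) (by omega)).2 (hf i)
    have h2 := (H.inverse (k : ℕ) (f k : ℕ) (by omega) (by omega) (by omega) (by omega)).2 (hf k)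
    rw [hik] at h1
    exact Fin.ext (by omega)
  refine ⟨Equiv.ofBijective f (Finite.injective_iff_bijective.1 hinj), hf, fun σ => ?_⟩
  have key : ∀ σ : Fin n ≃ Fin n, ∑ i : Fin n, (u (i : ℕ) + p (σ i : ℕ)) =
      ∑ i : Fin n, u (i : ℕ) + ∑ i : Fin n, p (i : ℕ) := fun σ => by
    rw [Finset.sum_add_distrib, Equiv.sum_comp σ fun j : Fin n => p (j : ℕ)]
  calc ∑ i : Fin n, w (i : ℕ) (σ i : ℕ)
      ≤ ∑ i : Fin n, (u (i : ℕ) + p (σ i : ℕ)) := Finset.sum_le_sum fun i _ =>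
        H.feasible _ _ (by omega) (by omega) (by omega) (by omega)
    _ = ∑ i : Fin n, (u (i : ℕ) + p (f i : ℕ)) := by
        rw [key, ← key (Equiv.ofBijective f (Finite.injective_iff_bijective.1 hinj))]; rfl
    _ = _ := Finset.sum_congr rfl fun i _ => by
        have := H.tight (i : ℕ) (by omega) (by omega) (by rw [hf]; omega)
        rw [hf] at this
        exact this.symm

end Hungarian

/-! ### The Hungarian method as a program -/

/-!
Arrays, with the names used for them in `DualMatching` and `Forest`:
* `0` the input, `1` the columns `X` of the rows, `2` the rows `M` of the columns;
* `3` and `4` the potentials `u` and `p`; `5` the addresses of the rows of the weight matrix;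
* `6`, `7`, `8` the forest `T`, `S`, `way`.

Variables, each in cell `0` of its array:
* `9` the next row address, `10` the unmatched column or hole `h`;
* `11`, `12`, `13` the slack, the row and the column of the best pair of a scan (the column is `-1`
  as long as there is none);
* `14`, `15` temporaries of the augmentation; `20`, …, `28` loop counters.
-/

namespace Hungarian

open RAM LoopProgram

/-- Cell `0` of array `k`, used as a variable. -/
def var (k : ℕ) : Expr := .read k (.const 0)

/-- The weight of the pair `(i, j)`; array `5` holds the address of the first entry of each row. -/
def weightExpr (i j : Expr) : Expr := .read 0 (.add (.read 5 i) j)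

/-- The slack of the pair `(i, j)`. -/
def slackExpr (i j : Expr) : Expr := .sub (.add (.read 3 i) (.read 4 j)) (weightExpr i j)

/-- The weight of the pair `(i, j)` in the memory `m`, see `weightExpr`. -/
def weightAt (m : Memory) (i j : ℤ) : ℤ := m 0 (m 5 i + j)

/-- Record the current pair as the best one seen. -/
def record : LoopProgram :=
  .seq (.write 11 (.const 0) (slackExpr (var 25) (var 26)))
    (.seq (.write 12 (.const 0) (var 25)) (.write 13 (.const 0) (var 26)))

/-- Record the current pair if it leaves the forest and beats the best pair so far. -/
def compare : LoopProgram :=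
  .ifPos (.read 7 (var 26)) .skip
    (.ifPos (.add (var 13) (.const 1))
      (.ifPos (.sub (var 11) (slackExpr (var 25) (var 26))) record .skip) record)

/-- Find the pair of a row of the forest and a column outside it that has the smallest slack. -/
def scan : LoopProgram :=
  .seq (.write 13 (.const 0) (.const (-1)))
    (.loop 25 (.ifPos (.read 6 (var 25)) (.loop 26 compare) .skip))

/-- Change the potentials by the smallest slack. -/
def shift : LoopProgram :=
  .loop 27
    (.seq (.ifPos (.read 6 (var 27))
        (.write 3 (var 27) (.sub (.read 3 (var 27)) (var 11))) .skip)
      (.ifPos (.read 7 (var 27))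
        (.write 4 (var 27) (.add (.read 4 (var 27)) (var 11))) .skip))

/-- Add the column found by the scan to the forest. -/
def attach : LoopProgram :=
  .seq (.write 7 (var 13) (.add (var 24) (.const 2)))
    (.seq (.write 8 (var 13) (var 12))
      (.ifPos (.add (.read 2 (var 13)) (.const 1))
        (.write 6 (.read 2 (var 13)) (.add (var 24) (.const 2)))
        (.write 10 (.const 0) (var 13))))

/-- One round of the search for an unmatched column. -/
def growStep : LoopProgram :=
  .ifPos (.sub (.const 0) (var 10)) (.seq scan (.seq shift attach)) .skip

/-- One step of the augmentation along the branch of the forest. -/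
def augmentStep : LoopProgram :=
  .ifPos (.add (var 10) (.const 1))
    (.seq (.write 15 (.const 0) (.read 8 (var 10)))
      (.seq (.write 14 (.const 0) (.read 1 (var 15)))
        (.seq (.write 2 (var 10) (var 15))
          (.seq (.write 1 (var 15) (var 10))
            (.write 10 (.const 0) (var 14)))))) .skip

/-- Start a new forest at the row in the counter `22`. -/
def plant : LoopProgram :=
  .seq (.loop 23 (.seq (.write 6 (var 23) (.const 0)) (.write 7 (var 23) (.const 0))))
    (.seq (.write 6 (var 22) (.const 1)) (.write 10 (.const 0) (.const (-1))))

/-- Match one more row. -/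
def phase : LoopProgram := .seq plant (.seq (.loop 24 growStep) (.loop 28 augmentStep))

/-- Raise the potential of the row in the counter `20` to the largest weight in that row. -/
def rowBound : LoopProgram :=
  .loop 21
    (.ifPos (.sub (weightExpr (var 20) (var 21)) (.read 3 (var 20)))
      (.write 3 (var 20) (weightExpr (var 20) (var 21))) .skip)

/-- Record the address of the row in the counter `20`, unmatch that row and the column of the same
number, and advance to the next address. -/
def clearRow : LoopProgram :=
  .seq (.write 5 (var 20) (.add (var 9) (.const 1)))
    (.seq (.write 9 (.const 0) (.add (var 9) (var 0)))
      (.seq (.write 1 (var 20) (.const (-1))) (.write 2 (var 20) (.const (-1)))))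

/-- Fill the table of row addresses, unmatch everything and choose feasible potentials. -/
def setup : LoopProgram :=
  .seq (.loop 20 (.write 9 (.const 0) (.add (var 9) (.add (var 0) (var 0)))))
    (.loop 20 (.seq clearRow rowBound))

/-- The Hungarian method for the matrix of values in the input. -/
def program : LoopProgram := .seq setup (.loop 22 phase)

/-- The arrays that may be written while the pairs are scanned. -/
def scanArrays : List ℕ := [11, 12, 13, 25, 26]

/-- In `m'`, the scan that was started in `m` has seen the pairs in `Z`: the best pair recorded
leaves the forest, and it beats all such pairs in `Z`. -/
structure Scanned (n : ℕ) (m : Memory) (Z : ℤ → ℤ → Prop) (m' : Memory) : Prop where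
  frame : ∀ k, k ∉ scanArrays → m' k = m k
  min : ∀ i j : ℤ, 0 ≤ i → i < n → 0 ≤ j → j < n → 0 < m 6 i → ¬ 0 < m 7 j → Z i j →
    0 ≤ m' 13 0 ∧ m' 11 0 ≤ m 3 i + m 4 j - weightAt m i j
  valid : 0 ≤ m' 13 0 → 0 ≤ m' 12 0 ∧ m' 12 0 < n ∧ m' 13 0 < n ∧ 0 < m 6 (m' 12 0) ∧
    ¬ 0 < m 7 (m' 13 0) ∧ m' 11 0 = m 3 (m' 12 0) + m 4 (m' 13 0) - weightAt m (m' 12 0) (m' 13 0)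

theorem Scanned.mono {n : ℕ} {m m' : Memory} {Z Z' : ℤ → ℤ → Prop} (H : Scanned n m Z m')
    (h : ∀ i j : ℤ, 0 ≤ i → i < n → 0 ≤ j → j < n → 0 < m 6 i → Z' i j → Z i j) :
    Scanned n m Z' m' :=
  ⟨H.frame, fun i j h1 h2 h3 h4 h5 h6 h7 => H.min i j h1 h2 h3 h4 h5 h6 (h i j h1 h2 h3 h4 h5 h7),
    H.valid⟩

theorem Scanned.store {n : ℕ} {m m' : Memory} {Z : ℤ → ℤ → Prop} (H : Scanned n m Z m')
    {k : ℕ} (hk : k = 25 ∨ k = 26) (i z : ℤ) : Scanned n m Z (m'.store k i z) := by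
  have h1 : ∀ k', k' ≠ 25 → k' ≠ 26 → m'.store k i z k' = m' k' := fun k' h1 h2 =>
    Memory.store_ne _ _ _ (by omega)
  constructor
  · intro k' hk'
    rw [h1 k' (by rintro rfl; simp [scanArrays] at hk') (by rintro rfl; simp [scanArrays] at hk')]
    exact H.frame k' hk'
  · simpa [h1] using H.min
  · simpa [h1] using H.valid

/-- Pairs are scanned in lexicographic order, and `compare` treats the pair `(r, c)`. -/
theorem Scanned.compare {n : ℕ} {m m' : Memory} {r c : ℕ}
    (H : Scanned n m (fun i j => i < r ∨ i = r ∧ j < c) m')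
    (hr : m' 25 0 = r) (hc : m' 26 0 = c) (hrn : r < n) (hcn : c < n) (hT : 0 < m 6 r) :
    Scanned n m (fun i j => i < r ∨ i = r ∧ j < c + 1) (compare.den n m') := by
  have e0 := H.frame 0 (by decide)
  have e3 := H.frame 3 (by decide)
  have e4 := H.frame 4 (by decide)
  have e5 := H.frame 5 (by decide)
  have e7 := H.frame 7 (by decide)
  have hv := H.valid
  simp only [Hungarian.compare, record, den, slackExpr, weightExpr, var, Expr.eval, hr, hc, e0, e3,
    e4, e5, e7]
  have hm := H.min
  by_cases hS : 0 < m 7 c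
  · simp only [hS, if_true]
    refine ⟨H.frame, fun i j h1 h2 h3 h4 h5 h6 h7 => ?_, H.valid⟩
    by_cases hjc : i = r ∧ j = c
    · obtain ⟨rfl, rfl⟩ := hjc; exact absurd hS h6
    · exact hm i j h1 h2 h3 h4 h5 h6 (by omega)
  simp only [hS, if_false]
  have hrec : (∀ i j : ℤ, 0 ≤ i → i < n → 0 ≤ j → j < n → 0 < m 6 i → ¬ 0 < m 7 j →
      i < r ∨ i = r ∧ j < c → m 3 r + m 4 c - weightAt m r c ≤ m 3 i + m 4 j - weightAt m i j) →
      Scanned n m (fun i j => i < r ∨ i = r ∧ j < c + 1)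
        (((m'.store 11 0 (m 3 r + m 4 c - m 0 (m 5 r + c))).store 12 0 r).store 13 0 c) := by
    intro hle
    constructor
    · intro k hk
      simp only [scanArrays, List.mem_cons, not_or] at hk
      rw [Memory.store_ne _ _ _ hk.2.2.1, Memory.store_ne _ _ _ hk.2.1, Memory.store_ne _ _ _ hk.1]
      exact H.frame k (by simp [scanArrays, hk])
    · intro i j h1 h2 h3 h4 h5 h6 h7
      refine ⟨by simp, ?_⟩
      simp only [ne_eq, Nat.reduceEqDiff, not_false_eq_true,
        Memory.store_ne, Memory.store_same, Function.update_self]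
      by_cases hjc : i = r ∧ j = c
      · obtain ⟨rfl, rfl⟩ := hjc; exact le_rfl
      · exact hle i j h1 h2 h3 h4 h5 h6 (by omega)
    · intro _
      simp [hrn, hcn, hT, weightAt]
      omega
  simp only [Memory.store_ne, hr, hc, ne_eq, Nat.reduceEqDiff, not_false_eq_true]
  split_ifs with h1 h2
  · refine hrec fun i j a1 a2 a3 a4 a5 a6 a7 => ?_
    have := (hm i j a1 a2 a3 a4 a5 a6 a7).2
    simp only [weightAt] at this ⊢
    omega
  · refine ⟨H.frame, fun i j a1 a2 a3 a4 a5 a6 a7 => ?_, H.valid⟩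
    by_cases hjc : i = r ∧ j = c
    · obtain ⟨rfl, rfl⟩ := hjc
      simp only [weightAt]
      omega
    · exact hm i j a1 a2 a3 a4 a5 a6 (by omega)
  · refine hrec fun i j a1 a2 a3 a4 a5 a6 a7 => ?_
    have := (hm i j a1 a2 a3 a4 a5 a6 a7).1
    omega

theorem scanned_scan (n : ℕ) (m : Memory) : Scanned n m (fun _ _ => True) (scan.den n m) := by
  have h0 : Scanned n m (fun i _ => i < (0 : ℕ)) (m.store 13 0 (-1)) := by
    refine ⟨fun k hk => ?_, fun i j h1 _ _ _ _ _ h => by omega, by simp⟩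
    exact Memory.store_ne _ _ _ (by rintro rfl; simp [scanArrays] at hk)
  refine Scanned.mono (Z := fun i _ => i < (n : ℕ)) ?_ (fun i j _ h _ _ _ _ => h)
  simp only [scan]
  rw [den]
  refine den_loop (fun r m' => Scanned n m (fun i _ => i < r) m') (h0.store (.inl rfl) _ _) ?_
  intro r hr m' hm' H
  refine Scanned.store ?_ (.inl rfl) _ _
  rw [den]
  simp only [var, Expr.eval, hm', H.frame 6 (by decide)]
  split_ifs with hT
  · refine Scanned.mono (Z := fun i j => i < r ∨ i = r ∧ j < n) ?_ (by push_cast; omega)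
    refine (den_loop (fun c m' => Scanned n m (fun i j => i < r ∨ i = r ∧ j < c) m' ∧ m' 25 0 = r)
      ⟨?_, by simpa using hm'⟩ ?_).1
    · exact (H.mono (by omega)).store (.inr rfl) _ _
    · rintro c hc m'' hm'' ⟨H', hr'⟩
      refine ⟨Scanned.store ?_ (.inr rfl) _ _, ?_⟩
      · exact H'.compare hr' hm'' hr hc hT
      · rw [Memory.store_ne _ _ _ (by decide), den_frame _ _ _ (by decide), hr']
  · refine H.mono fun i j _ _ _ _ hi h => ?_
    have : i ≠ r := by rintro rfl; exact hT hi
    push_cast at h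
    omega

theorem weightAt_congr {m m' : Memory} (h0 : m' 0 = m 0) (h5 : m' 5 = m 5) :
    weightAt m' = weightAt m := by
  funext i j; simp [weightAt, h0, h5]

/-- The effect of a conditional write at the position of a counter. -/
theorem den_update (n k l c : ℕ) (e : Expr) (m : Memory) :
    (LoopProgram.ifPos (.read k (var c)) (.write l (var c) e) .skip).den n m l =
      Function.update (m l) (m c 0) (if 0 < m k (m c 0) then e.eval m else m l (m c 0)) := by
  by_cases h : 0 < (Expr.read k (var c)).eval m
  · rw [den_ifPos_pos h]
    simp only [var, Expr.eval] at h
    simp [den, var, Expr.eval, h]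
  · rw [den_ifPos_neg h]
    simp only [var, Expr.eval] at h
    simp [den, h]

/-- The loop `shift` has the effect that `DualMatching.shift` asks for. -/
theorem den_shift (n : ℕ) (m : Memory) :
    (∀ i : ℤ, 0 ≤ i → i < n → shift.den n m 3 i = if 0 < m 6 i then m 3 i - m 11 0 else m 3 i) ∧
    (∀ j : ℤ, 0 ≤ j → j < n → shift.den n m 4 j = if 0 < m 7 j then m 4 j + m 11 0 else m 4 j) := by
  have key : ∀ i : ℤ,
      (shift.den n m 3 i = if (0 ≤ i ∧ i < n) ∧ 0 < m 6 i then m 3 i - m 11 0 else m 3 i) ∧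
      (shift.den n m 4 i = if (0 ≤ i ∧ i < n) ∧ 0 < m 7 i then m 4 i + m 11 0 else m 4 i) := by
    refine (den_loop (fun r m' => (m' 6 = m 6 ∧ m' 7 = m 7 ∧ m' 11 = m 11) ∧ ∀ i : ℤ,
      (m' 3 i = if (0 ≤ i ∧ i < r) ∧ 0 < m 6 i then m 3 i - m 11 0 else m 3 i) ∧
      (m' 4 i = if (0 ≤ i ∧ i < r) ∧ 0 < m 7 i then m 4 i + m 11 0 else m 4 i)) ?_ ?_).2
    · refine ⟨by simp, fun i => ?_⟩
      simp
    · rintro r hr m' hm' ⟨⟨h6, h7, h11⟩, H⟩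
      refine ⟨⟨?_, ?_, ?_⟩, fun i => ?_⟩
      · rw [Memory.store_ne _ _ _ (by decide), den_frame _ _ _ (by decide), h6]
      · rw [Memory.store_ne _ _ _ (by decide), den_frame _ _ _ (by decide), h7]
      · rw [Memory.store_ne _ _ _ (by decide), den_frame _ _ _ (by decide), h11]
      · have body : let m'' := (seq (ifPos (.read 6 (var 27))
              (write 3 (var 27) (.sub (.read 3 (var 27)) (var 11))) skip)
            (ifPos (.read 7 (var 27))
              (write 4 (var 27) (.add (.read 4 (var 27)) (var 11))) skip)).den n m'
            m'' 3 = Function.update (m' 3) r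
              (if 0 < m 6 r then m' 3 r - m 11 0 else m' 3 r) ∧
            m'' 4 = Function.update (m' 4) r
              (if 0 < m 7 r then m' 4 r + m 11 0 else m' 4 r) := by
          rw [den]
          set q := (ifPos (.read 6 (var 27))
            (write 3 (var 27) (.sub (.read 3 (var 27)) (var 11))) skip).den n m' with hq
          have f : ∀ k, k ≠ 3 → q k = m' k := fun k hk => den_frame _ _ _ (by simp [writes, hk])
          constructor
          · rw [den_frame _ _ _ (by decide), hq, den_update]
            simp [var, Expr.eval, h6, h11, hm']
          · rw [den_update]
            simp [var, Expr.eval, h7, h11, hm', f]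
        obtain ⟨b3, b4⟩ := body
        rw [Memory.store_ne _ _ _ (by decide), Memory.store_ne _ _ _ (by decide), b3, b4]
        obtain ⟨hi3, hi4⟩ := H i
        by_cases hir : i = r
        · subst hir
          have e0 : ¬ (r : ℤ) < r := by omega
          have e1 : (r : ℤ) < ((r + 1 : ℕ) : ℤ) := by omega
          have e2 : (0 : ℤ) ≤ r := by omega
          rw [if_neg (by tauto)] at hi3 hi4
          simp only [Function.update_self, hi3, hi4, e1, e2, and_self, true_and]
        · have e1 : 0 ≤ i ∧ i < ((r + 1 : ℕ) : ℤ) ↔ 0 ≤ i ∧ i < r := by omega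
          simp only [Function.update_of_ne hir, hi3, hi4, e1, and_self]
  refine ⟨fun i h0 hn => ?_, fun j h0 hn => ?_⟩
  · simpa [h0, hn] using (key i).1
  · simpa [h0, hn] using (key j).2

/-! ### Correctness of the search and of the augmentation -/

/-- The state before round `r` of the search from row `b`.  Once the search has ended, the number
`t` of growth steps may stay behind `r`. -/
def Searching (n b : ℕ) (r : ℕ) (m : Memory) : Prop :=
  DualMatching n b (weightAt m) (m 1) (m 2) (m 3) (m 4) ∧
  ∃ t : ℤ, 0 ≤ t ∧ t ≤ r ∧ (m 10 0 < 0 → t = r) ∧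
    Forest n b t (weightAt m) (m 1) (m 2) (m 3) (m 4) (m 6) (m 7) (m 8) (m 10 0)

theorem Searching.store {n b r : ℕ} {m : Memory} (H : Searching n b r m) {k : ℕ} (hk : 10 < k)
    (i z : ℤ) : Searching n b r (m.store k i z) := by
  have h : ∀ k', k' ≤ 10 → m.store k i z k' = m k' := fun k' h =>
    Memory.store_ne _ _ _ (by omega)
  have hw : weightAt (m.store k i z) = weightAt m :=
    weightAt_congr (h 0 (by omega)) (h 5 (by omega))
  simpa only [Searching, hw, h 1 (by omega), h 2 (by omega), h 3 (by omega), h 4 (by omega),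
    h 6 (by omega), h 7 (by omega), h 8 (by omega), h 10 (by omega)] using H

theorem Searching.growStep {n b r : ℕ} {m : Memory} (H : Searching n b r m) (hb : b < n)
    (hr : m 24 0 = r) : Searching n b (r + 1) (growStep.den n m) := by
  obtain ⟨D, t, ht0, htr, hth, F⟩ := H
  rw [Hungarian.growStep]
  by_cases hh : 0 < (Expr.sub (.const 0) (var 10)).eval m
  swap
  · rw [den_ifPos_neg hh, den]
    simp only [var, Expr.eval] at hh
    exact ⟨D, t, ht0, by push_cast; omega, by omega, F⟩
  rw [den_ifPos_pos hh]
  replace hh : m 10 0 < 0 := by simp only [var, Expr.eval] at hh; omega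
  obtain rfl := hth hh
  rw [den, den]
  have Sc := scanned_scan n m
  set m₁ := scan.den n m
  have f₁ : ∀ k ∉ scan.writes, m₁ k = m k := fun k hk => den_frame n scan m hk
  obtain ⟨hu, hp⟩ := den_shift n m₁
  set m₂ := shift.den n m₁
  have f₂ : ∀ k ∉ shift.writes, m₂ k = m₁ k := fun k hk => den_frame n shift m₁ hk
  have g : ∀ k, k ∉ shift.writes → k ∉ scan.writes → m₂ k = m k := fun k h h' => by
    rw [f₂ k h, f₁ k h']
  rw [f₁ 3 (by decide), f₁ 6 (by decide)] at hu
  rw [f₁ 4 (by decide), f₁ 7 (by decide)] at hp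
  -- Some column is unmatched, and it is outside the forest, so the scan has found a pair.
  have hj0 : 0 ≤ m₁ 13 0 := by
    obtain ⟨j, h1, h2, h3⟩ := D.exists_free (by omega) (by omega)
    refine (Sc.min b j (by omega) (by omega) h1 h2 (by rw [F.root]; omega) (fun hS => ?_)
      trivial).1
    have := (F.searching hh).1 j h1 h2 hS
    omega
  obtain ⟨hi0, hin, hjn, hT, hS, hδ⟩ := Sc.valid hj0
  set i₁ := m₁ 12 0
  set j₁ := m₁ 13 0
  set δ := m₁ 11 0
  have hδ0 : 0 ≤ δ := by
    have := D.feasible i₁ j₁ hi0 hin hj0 hjn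
    omega
  have D' := D.shift F (fun i j h1 h2 h3 h4 h5 h6 => (Sc.min i j h1 h2 h3 h4 h5 h6 trivial).2)
    hδ0 hu hp
  have F' := Forest.grow D F hh ht0 (by omega) (by omega) hi0 hin hj0 hjn hT hS hδ hu hp
    rfl rfl rfl rfl
  have hMj := D.lt_col j₁ hj0 hjn
  have e12 : m₂ 12 0 = i₁ := by rw [f₂ 12 (by decide)]
  have e13 : m₂ 13 0 = j₁ := by rw [f₂ 13 (by decide)]
  have e24 : m₂ 24 0 = r := by rw [g 24 (by decide) (by decide), hr]
  have e2 : m₂ 2 = m 2 := g 2 (by decide) (by decide)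
  have e0 : m₂ 0 = m 0 := g 0 (by decide) (by decide)
  have e5 : m₂ 5 = m 5 := g 5 (by decide) (by decide)
  -- It remains to read off the effect of `attach` on each array.
  have fin : ∀ m₃ : Memory, m₃ 0 = m 0 → m₃ 5 = m 5 → m₃ 1 = m 1 → m₃ 2 = m 2 → m₃ 3 = m₂ 3 →
      m₃ 4 = m₂ 4 → m₃ 7 = Function.update (m 7) j₁ (r + 2) →
      m₃ 8 = Function.update (m 8) j₁ i₁ →
      m₃ 6 = (if 0 ≤ m 2 j₁ then Function.update (m 6) (m 2 j₁) (r + 2) else m 6) →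
      m₃ 10 0 = (if 0 ≤ m 2 j₁ then m 10 0 else j₁) → Searching n b (r + 1) m₃ := by
    intro m₃ a0 a5 a1 a2 a3 a4 a7 a8 a6 a10
    refine ⟨?_, r + 1, by omega, by push_cast; omega, by push_cast; omega, ?_⟩
    · rw [weightAt_congr a0 a5, a1, a2, a3, a4]; exact D'
    · rw [weightAt_congr a0 a5, a1, a2, a3, a4, a6, a7, a8, a10]; exact F'
  by_cases hM : 0 ≤ m 2 j₁
  · have hM' : 0 < m 2 j₁ + 1 := by omega
    apply fin <;>
      simp [attach, den, var, Expr.eval, e12, e13, e24, e2, e0, e5, hM, hM',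
        g 1 (by decide) (by decide), g 6 (by decide) (by decide), g 7 (by decide) (by decide),
        g 8 (by decide) (by decide), g 10 (by decide) (by decide)]
  · have hM' : ¬ 0 < m 2 j₁ + 1 := by omega
    apply fin <;>
      simp [attach, den, var, Expr.eval, e12, e13, e24, e2, e0, e5, hM, hM',
        g 1 (by decide) (by decide), g 6 (by decide) (by decide), g 7 (by decide) (by decide),
        g 8 (by decide) (by decide), g 10 (by decide) (by decide)]

/-- The state before round `r` of the augmentation that matches row `b`.  The ranks in the forest
are at most `n + 1` at the start, and the rank of the hole drops in every round. -/
def AugmentingAt (n b : ℕ) (r : ℕ) (m : Memory) : Prop :=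
  Augmenting n b ((n : ℤ) + 1 - r) (weightAt m) (m 1) (m 2) (m 3) (m 4) (m 6) (m 7) (m 8) (m 10 0) ∧
    -1 ≤ m 10 0

theorem AugmentingAt.store {n b r : ℕ} {m : Memory} (H : AugmentingAt n b r m) {k : ℕ}
    (hk : 10 < k) (i z : ℤ) : AugmentingAt n b r (m.store k i z) := by
  have h : ∀ k', k' ≤ 10 → m.store k i z k' = m k' := fun k' h =>
    Memory.store_ne _ _ _ (by omega)
  have hw : weightAt (m.store k i z) = weightAt m :=
    weightAt_congr (h 0 (by omega)) (h 5 (by omega))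
  simpa only [AugmentingAt, hw, h 1 (by omega), h 2 (by omega), h 3 (by omega), h 4 (by omega),
    h 6 (by omega), h 7 (by omega), h 8 (by omega), h 10 (by omega)] using H

theorem AugmentingAt.augmentStep {n b r : ℕ} {m : Memory} (H : AugmentingAt n b r m) :
    AugmentingAt n b (r + 1) (augmentStep.den n m) := by
  obtain ⟨G, hh⟩ := H
  rw [Hungarian.augmentStep]
  by_cases h : 0 < (Expr.add (var 10) (.const 1)).eval m
  · rw [den_ifPos_pos h]
    simp only [var, Expr.eval] at h ⊢
    have h0 : 0 ≤ m 10 0 := by omega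
    have G' := G.step h0 rfl rfl
    obtain ⟨⟨h1, h2, h3⟩, -, -⟩ := G.hole h0
    obtain ⟨c1, c2, -⟩ := G.col _ h0 h1 h2
    have hX := G.lt_row _ c1 c2
    rw [show (n : ℤ) + 1 - r - 1 = n + 1 - ((r + 1 : ℕ) : ℤ) by push_cast; ring] at G'
    simp only [den, Expr.eval, AugmentingAt]
    rw [weightAt_congr (m := m) (by simp) (by simp)]
    simpa using And.intro G' hX.2
  · rw [den_ifPos_neg h, den]
    simp only [var, Expr.eval] at h
    refine ⟨?_, hh⟩
    exact { G with hole := fun h' => by omega }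

theorem den_plant {n b : ℕ} {m : Memory} (hb : m 22 0 = b) :
    (∀ i : ℤ, 0 ≤ i → i < n → i ≠ b → plant.den n m 6 i = 0) ∧ plant.den n m 6 b = 1 ∧
    (∀ i : ℤ, 0 ≤ i → i < n → plant.den n m 7 i = 0) ∧ plant.den n m 10 0 = -1 := by
  rw [plant, den]
  set q := LoopProgram.loop 23
    (.seq (.write 6 (var 23) (.const 0)) (.write 7 (var 23) (.const 0))) with hq
  have key : ∀ i : ℤ, 0 ≤ i → i < n → q.den n m 6 i = 0 ∧ q.den n m 7 i = 0 := by
    refine den_loop (fun r m' => ∀ i : ℤ, 0 ≤ i → i < r → m' 6 i = 0 ∧ m' 7 i = 0)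
      (by intro i; push_cast; omega) ?_
    intro r hr m' hm' H i h0 hi
    by_cases hir : i = r
    · simp [den, var, Expr.eval, hm', hir]
    · simpa [den, var, Expr.eval, hm', hir] using H i h0 (by push_cast at hi; omega)
  have h22 : q.den n m 22 0 = b := by rw [den_frame _ _ _ (by decide), hb]
  refine ⟨fun i h0 hi hib => ?_, ?_, fun i h0 hi => ?_, ?_⟩
  · simpa [den, var, Expr.eval, h22, hib] using (key i h0 hi).1
  · simp [den, var, Expr.eval, h22]
  · simpa [den, var, Expr.eval, h22] using (key i h0 hi).2
  · simp [den, var, Expr.eval]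

/-- A phase matches one more row: the search and the augmentation are both over within `n`
rounds. -/
theorem DualMatching.phase {n b : ℕ} {m : Memory} (hb : b < n) (hm : m 22 0 = b)
    (D : DualMatching n b (weightAt m) (m 1) (m 2) (m 3) (m 4)) :
    DualMatching n (b + 1 : ℕ) (weightAt (phase.den n m)) (phase.den n m 1) (phase.den n m 2)
      (phase.den n m 3) (phase.den n m 4) := by
  rw [Hungarian.phase, den, den]
  obtain ⟨hT, hTb, hS, hh⟩ := den_plant (n := n) hm
  set m₁ := plant.den n m
  have f₁ : ∀ k ∉ plant.writes, m₁ k = m k := fun k hk => den_frame n plant m hk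
  have S₀ : Searching n b 0 m₁ := by
    refine ⟨?_, 0, le_rfl, by simp, by simp, ?_⟩
    · rw [weightAt_congr (f₁ 0 (by decide)) (f₁ 5 (by decide)), f₁ 1 (by decide), f₁ 2 (by decide),
        f₁ 3 (by decide), f₁ 4 (by decide)]
      exact D
    · rw [hh]
      exact Forest.init (by omega) hT hTb hS
  have S₁ : Searching n b n ((loop 24 growStep).den n m₁) := by
    refine den_loop (Searching n b) (S₀.store (by omega) _ _) ?_
    intro r hr m' hm' H
    exact (H.growStep hb hm').store (by omega) _ _
  set m₂ := (loop 24 growStep).den n m₁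
  obtain ⟨D₂, t, ht0, htn, hth, F⟩ := S₁
  have hh₂ : 0 ≤ m₂ 10 0 := by
    by_contra! hneg
    have := F.lt D₂ (by omega) (by omega) hneg
    have := hth hneg
    omega
  have A₀ : AugmentingAt n b 0 m₂ := by
    have G := Augmenting.init D₂ F hh₂
    refine ⟨{ G with hole := fun h => ?_ }, by omega⟩
    obtain ⟨⟨h1, h2, h3⟩, h4⟩ := G.hole h
    exact ⟨⟨h1, h2, by push_cast; omega⟩, h4⟩
  have A₁ : AugmentingAt n b n ((loop 28 augmentStep).den n m₂) := by
    refine den_loop (AugmentingAt n b) (A₀.store (by omega) _ _) ?_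
    intro r hr m' hm' H
    exact H.augmentStep.store (by omega) _ _
  set m₃ := (loop 28 augmentStep).den n m₂
  obtain ⟨G, -⟩ := A₁
  have hh₃ : m₃ 10 0 < 0 := by
    -- A hole has rank at least `2`, because its parent in the forest has positive rank.
    by_contra! h0
    obtain ⟨⟨h1, h2, h3⟩, -, -⟩ := G.hole h0
    have := G.col _ h0 h1 h2
    omega
  simpa using G.dualMatching hh₃

/-! ### Correctness of the whole program -/

theorem den_rowBound (n : ℕ) {m : Memory} {r : ℤ} (hr : m 20 0 = r) :
    (∀ j : ℤ, 0 ≤ j → j < n → weightAt m r j ≤ rowBound.den n m 3 r) ∧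
    ∀ i : ℤ, i ≠ r → rowBound.den n m 3 i = m 3 i := by
  refine (den_loop (fun c m' => (m' 0 = m 0 ∧ m' 5 = m 5 ∧ m' 20 0 = r) ∧
    (∀ j : ℤ, 0 ≤ j → j < c → weightAt m r j ≤ m' 3 r) ∧ ∀ i : ℤ, i ≠ r → m' 3 i = m 3 i) ?_ ?_).2
  · exact ⟨by simpa using hr, fun j => by push_cast; omega, by simp⟩
  · rintro c hc m' hm' ⟨⟨e0, e5, e20⟩, H, H'⟩
    have hr' : (var 20).eval m' = r := by simp [var, Expr.eval, e20]
    have hw : (weightExpr (var 20) (var 21)).eval m' = weightAt m r c := by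
      simp [weightExpr, var, Expr.eval, weightAt, e0, e5, e20, hm']
    have hd : (Expr.sub (weightExpr (var 20) (var 21)) (.read 3 (var 20))).eval m' =
        weightAt m r c - m' 3 r := by simp only [Expr.eval, hw, hr']
    constructor
    · rw [Memory.store_ne _ _ _ (by decide), Memory.store_ne _ _ _ (by decide),
        Memory.store_ne _ _ _ (by decide), den_frame _ _ _ (by decide),
        den_frame _ _ _ (by decide), den_frame _ _ _ (by decide)]
      exact ⟨e0, e5, e20⟩
    · rw [Memory.store_ne _ _ _ (by decide)]
      have hcj : ∀ j : ℤ, j < ((c + 1 : ℕ) : ℤ) → j = c ∨ j < c := by intro j; push_cast; omega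
      by_cases h : 0 < weightAt m r c - m' 3 r
      · rw [den_ifPos_pos (by rwa [hd]), den, hw, hr', Memory.store_same, Function.update_self]
        refine ⟨fun j h0 hj => ?_, fun i hi => by rw [Function.update_of_ne hi, H' i hi]⟩
        rcases hcj j hj with rfl | hj
        · exact le_rfl
        · have := H j h0 hj; omega
      · rw [den_ifPos_neg (by rwa [hd]), den]
        refine ⟨fun j h0 hj => ?_, H'⟩
        rcases hcj j hj with rfl | hj
        · omega
        · exact H j h0 hj

/-- The values start at address `1 + 2 * n * n`; the empty matching and the row maxima satisfy the
invariant. -/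
theorem den_setup {n : ℕ} {m : Memory} (h00 : m 0 0 = n) (hz : ∀ k, k ≠ 0 → ∀ i, m k i = 0) :
    (∀ i : ℤ, 0 ≤ i → i < n → setup.den n m 5 i = 1 + 2 * n * n + i * n) ∧
    DualMatching n (0 : ℕ) (weightAt (setup.den n m)) (setup.den n m 1) (setup.den n m 2)
      (setup.den n m 3) (setup.den n m 4) := by
  rw [setup, den]
  set m₁ := (loop 20 (.write 9 (.const 0) (.add (var 9) (.add (var 0) (var 0))))).den n m
  have f₁ : ∀ k, k ≠ 20 → k ≠ 9 → m₁ k = m k := fun k h h' => den_frame _ _ _ (by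
    simp [writes, h, h'])
  have h9 : m₁ 9 0 = 2 * n * n := by
    refine (den_loop (fun r m' => m' 0 = m 0 ∧ m' 9 0 = 2 * n * r) ?_ ?_).2
    · simp [hz]
    · rintro r hr m' hm' ⟨e0, e9⟩
      simp [den, var, Expr.eval, e0, e9, h00]
      ring
  have key := den_loop (n := n) (c := 20) (m := m₁) (p := .seq clearRow rowBound)
    (fun r m' => (m' 0 = m 0 ∧ m' 4 = m 4 ∧ m' 9 0 = 2 * n * n + r * n) ∧ ∀ i : ℤ, 0 ≤ i → i < r →
      (m' 5 i = 1 + 2 * n * n + i * n ∧ m' 1 i = -1 ∧ m' 2 i = -1) ∧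
      ∀ j : ℤ, 0 ≤ j → j < n → m 0 (1 + 2 * n * n + i * n + j) ≤ m' 3 i) ?_ ?_
  · obtain ⟨⟨e0, e4, -⟩, H⟩ := key
    set m₂ := (loop 20 (.seq clearRow rowBound)).den n m₁
    have a1 : ∀ i : ℤ, 0 ≤ i → i < n → m₂ 1 i = -1 := fun i h0 hi => (H i h0 hi).1.2.1
    have a2 : ∀ i : ℤ, 0 ≤ i → i < n → m₂ 2 i = -1 := fun i h0 hi => (H i h0 hi).1.2.2
    refine ⟨fun i h0 hi => (H i h0 hi).1.1, ?_, ?_, ?_, ?_, ?_, ?_⟩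
    · intro i j hi0 hin hj0 hjn
      rw [weightAt, e0, e4, hz 4 (by decide), (H i hi0 hin).1.1]
      have := (H i hi0 hin).2 j hj0 hjn
      omega
    · intro i h0 hi hX; have := a1 i h0 hi; omega
    · intro i h0 hi; have := a1 i h0 hi; omega
    · intro i h0 hi; have := a2 i h0 hi; omega
    · intro i h0 hi; have := a1 i h0 hi; omega
    · intro i j hi0 hin hj0 hjn
      have := a1 i hi0 hin
      have := a2 j hj0 hjn
      omega
  · exact ⟨by simp [f₁, h9], fun i => by push_cast; omega⟩
  · rintro r hr m' hm' ⟨⟨e0, e4, e9⟩, H⟩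
    rw [den]
    set m₂ := clearRow.den n m' with hm₂
    have g0 : m₂ 0 = m 0 := by simp [hm₂, clearRow, den, e0]
    have g1 : m₂ 1 = Function.update (m' 1) r (-1) := by
      simp [hm₂, clearRow, den, var, Expr.eval, hm']
    have g2 : m₂ 2 = Function.update (m' 2) r (-1) := by
      simp [hm₂, clearRow, den, var, Expr.eval, hm']
    have g3 : m₂ 3 = m' 3 := by simp [hm₂, clearRow, den]
    have g4 : m₂ 4 = m 4 := by simp [hm₂, clearRow, den, e4]
    have g5 : m₂ 5 = Function.update (m' 5) r (1 + 2 * n * n + r * n) := by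
      simp [hm₂, clearRow, den, var, Expr.eval, hm', e9]; congr 1; ring
    have g9 : m₂ 9 0 = 2 * n * n + (r + 1 : ℕ) * n := by
      simp [hm₂, clearRow, den, var, Expr.eval, e9, e0, h00]; ring
    have g20 : m₂ 20 0 = r := by simp [hm₂, clearRow, den, hm']
    obtain ⟨hB, hB'⟩ := den_rowBound n g20
    have f : ∀ k, k ≠ 3 → k ≠ 21 → k ≠ 20 →
        ((rowBound.den n m₂).store 20 0 ((r : ℤ) + 1)) k = m₂ k := fun k h h' h'' => by
      rw [Memory.store_ne _ _ _ h'', den_frame _ _ _ (by simp [rowBound, writes, h, h'])]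
    rw [f 0 (by decide) (by decide) (by decide), f 1 (by decide) (by decide) (by decide),
      f 2 (by decide) (by decide) (by decide), f 4 (by decide) (by decide) (by decide),
      f 5 (by decide) (by decide) (by decide), f 9 (by decide) (by decide) (by decide),
      Memory.store_ne _ _ _ (show 3 ≠ 20 by decide), g1, g2, g5]
    refine ⟨⟨g0, g4, g9⟩, fun i h0 hi => ?_⟩
    by_cases hir : i = r
    · subst hir
      refine ⟨by simp, fun j hj0 hjn => ?_⟩
      have := hB j hj0 hjn
      simpa [weightAt, g5, g0] using this
    · simp only [Function.update_of_ne hir, hB' i hir, g3]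
      exact H i h0 (by push_cast at hi; omega)

theorem den_program {n : ℕ} {m : Memory} (h00 : m 0 0 = n) (hz : ∀ k, k ≠ 0 → ∀ i, m k i = 0) :
    DualMatching n n (weightAt (program.den n m)) (program.den n m 1)
      (program.den n m 2) (program.den n m 3) (program.den n m 4) ∧
    ∀ i : ℤ, 0 ≤ i → i < n → program.den n m 5 i = 1 + 2 * n * n + i * n := by
  obtain ⟨h5, D⟩ := den_setup h00 hz
  rw [program, den]
  refine den_loop (fun b m' => DualMatching n b (weightAt m') (m' 1) (m' 2) (m' 3) (m' 4) ∧
    ∀ i : ℤ, 0 ≤ i → i < n → m' 5 i = 1 + 2 * n * n + i * n) ⟨?_, ?_⟩ ?_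
  · rw [weightAt_congr (m := setup.den n m) (by simp) (by simp)]
    simpa using D
  · simpa using h5
  · rintro b hb m' hm' ⟨D', h5'⟩
    constructor
    · rw [weightAt_congr (m := phase.den n m') (by simp) (by simp)]
      simpa using D'.phase hb hm'
    · rw [Memory.store_ne _ _ _ (by decide), den_frame _ _ _ (by decide)]
      exact h5'

end Hungarian

/-! ### Core stability of maximum-value allocations -/

namespace ExchangeMarket

/-- In a uniform problem the network part of the utility is, up to an amount that depends only on
the agent, a function of the item alone. -/
theorem exists_utility_eq {N A : Type*} [Fintype N] [Fintype A] (M : ExchangeMarket N A)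
    (hM : M.AgentsUniform ∨ M.ItemsUniform) :
    ∃ (d : N → ℤ) (g : A → ℤ), ∀ (π : N ≃ A) (i : N),
      M.utility π i = M.value i (π i) + d i + g (π i) := by
  classical
  rcases hM with (h | ⟨h, c, hc⟩) | h | h
  · exact ⟨0, 0, fun π i => by simp [utility, h]⟩
  · refine ⟨0, fun a => ∑ b : A, if M.itemGraph.Adj b a then (c : ℤ) else 0, fun π i => ?_⟩
    simp only [utility, Pi.zero_apply, add_zero]
    -- Summing over the agents `j` amounts to summing over the items `π j`.
    rw [← Equiv.sum_comp π fun b => if M.itemGraph.Adj b (π i) then (c : ℤ) else 0]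
    congr 1
    refine Finset.sum_congr rfl fun j _ => ?_
    by_cases hj : M.itemGraph.Adj (π j) (π i)
    · have hji : M.agentGraph.Adj j i := by
        rw [h, SimpleGraph.top_adj]
        rintro rfl
        exact hj.ne rfl
      have := hc s(j, i) ((SimpleGraph.mem_edgeSet _).2 hji)
      simp [hj, hji, this]
    · simp [hj]
  · exact ⟨0, 0, fun π i => by simp [utility, h]⟩
  · refine ⟨fun i => ∑ j : N, if M.agentGraph.Adj j i then (M.weight s(j, i) : ℤ) else 0, 0,
      fun π i => ?_⟩
    simp only [utility, Pi.zero_apply, add_zero]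
    congr 1
    refine Finset.sum_congr rfl fun j _ => ?_
    by_cases hj : M.agentGraph.Adj j i
    · simp [hj, h, hj.ne]
    · simp [hj]

/-- A permissible blocking exchange would raise the total utility of its members; their items stay
among them, so it would raise the total value. -/
theorem isCoreStable_of_value_max {N A : Type*} [Fintype N] [DecidableEq N] [Fintype A]
    (M : ExchangeMarket N A) (hM : M.AgentsUniform ∨ M.ItemsUniform) (π : N ≃ A)
    (hπ : ∀ σ : N ≃ A, ∑ i, (M.value i (σ i) : ℤ) ≤ ∑ i, (M.value i (π i) : ℤ)) :
    M.IsCoreStable π := by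
  rintro ⟨E, -, hE, hblock⟩
  obtain ⟨d, g, hu⟩ := M.exists_utility_eq hM
  set σ := E.apply π with hσ
  have h1 : ∑ x ∈ E.members, M.utility π x <
      ∑ x ∈ E.members, (M.utility σ x - M.cost x (π x) (σ x)) :=
    Finset.sum_lt_sum_of_nonempty E.nonempty hblock
  rw [Finset.sum_sub_distrib] at h1
  have h2 : 0 ≤ ∑ x ∈ E.members, M.cost x (π x) (σ x) := hE
  have h3 : ∀ x ∉ E.members, σ x = π x := fun x hx => by
    simp [hσ, CoalitionalExchange.apply, Equiv.Perm.ofSubtype_apply_of_not_mem E.perm hx]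
  have hext : ∀ f : N → A → ℤ, ∑ x, f x (σ x) - ∑ x, f x (π x) =
      ∑ x ∈ E.members, f x (σ x) - ∑ x ∈ E.members, f x (π x) := fun f => by
    rw [← Finset.sum_sub_distrib, ← Finset.sum_sub_distrib]
    refine (Finset.sum_subset (Finset.subset_univ _) fun x _ hx => ?_).symm
    rw [h3 x hx, sub_self]
  have h4 := hext fun x a => M.value x a
  -- The part `g` of the utility that depends on the item alone has the same total under both
  -- allocations.
  have h5 := hext fun _ a => g a
  rw [Equiv.sum_comp σ g, Equiv.sum_comp π g] at h5
  have h6 := hπ σ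
  simp only [hu, Finset.sum_add_distrib] at h1
  omega

end ExchangeMarket

/-! ### Reading the input -/

/-- Row-major addressing in a concatenation of blocks of equal length. -/
theorem List.getD_flatMap_of_length {α β : Type*} (f : α → List β) (d : β) {L : ℕ}
    (hf : ∀ x, (f x).length = L) (l : List α) (k j : ℕ) (hk : k < l.length) (hj : j < L) :
    (l.flatMap f).getD (k * L + j) d = (f l[k]).getD j d := by
  induction l generalizing k with
  | nil => simp at hk
  | cons a l ih =>
    rw [List.flatMap_cons]
    cases k with
    | zero => rw [List.getD_append _ _ _ _ (by rw [hf]; omega)]; simp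
    | succ k =>
      rw [List.getD_append_right _ _ _ _ (by rw [hf, Nat.succ_mul]; omega), hf,
        show (k + 1) * L + j - L = k * L + j by rw [Nat.succ_mul]; omega,
        ih k (by simpa using hk)]
      simp

theorem List.length_flatMap_of_length {α β : Type*} (f : α → List β) {L : ℕ}
    (hf : ∀ x, (f x).length = L) (l : List α) : (l.flatMap f).length = l.length * L := by
  simp [List.length_flatMap, hf]

namespace ExchangeMarket

variable {n : ℕ} (M : ExchangeMarket (Fin n) (Fin n))

theorem getD_encode_zero : M.encode.getD 0 0 = n := by simp [encode]

/-- The values stand behind the number `n` and two `n × n` matrices. -/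
theorem getD_encode_value (i j : Fin n) :
    M.encode.getD (1 + 2 * n * n + i * n + j) 0 = M.value i j := by
  classical
  have len : ∀ (f : Fin n → Fin n → ℤ), ((List.finRange n).flatMap fun i =>
      (List.finRange n).map fun j => f i j).length = n * n := fun f => by
    rw [List.length_flatMap_of_length (L := n) _ (by simp)]; simp
  have hij : (i : ℕ) * n + j < n * n := by
    have : (i : ℕ) * n + n ≤ n * n := by rw [← Nat.succ_mul]; exact Nat.mul_le_mul_right n i.2
    omega
  rw [encode, List.getD_append, List.getD_append_right, List.length_append, List.length_cons, len,
    len, show 1 + 2 * n * n + (i : ℕ) * n + j - (n * n + 1 + n * n) = i * n + j by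
      rw [mul_assoc]; omega,
    List.getD_flatMap_of_length (L := n) _ _ (by simp) _ _ _ (by simp) j.2]
  · simp
  · simp only [List.length_append, List.length_cons, len]; rw [mul_assoc]; omega
  · simp only [List.length_append, List.length_cons, len]; rw [mul_assoc]; omega

theorem le_inputLength_encode : n ≤ RAM.inputLength M.encode := by
  have h1 : ∀ l : List ℤ, l.length ≤ RAM.inputLength l := fun l => by
    induction l with
    | nil => simp
    | cons a l ih => simp only [RAM.inputLength, List.map_cons, List.sum_cons,
        List.length_cons] at ih ⊢; omega
  refine le_trans ?_ (h1 _)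
  have : n ≤ n * n := Nat.le_mul_self n
  simp only [encode, List.length_append, List.length_cons]
  rw [List.length_flatMap_of_length (L := n) _ (by simp)]
  simp only [List.length_finRange]
  omega

end ExchangeMarket

/-! ### Core-stable allocations in polynomial time -/

theorem Polynomial.eval_le_eval_nat (p : Polynomial ℕ) {a b : ℕ} (h : a ≤ b) :
    p.eval a ≤ p.eval b := by
  simp only [Polynomial.eval_eq_sum, Polynomial.sum]
  gcongr

theorem mainTheorem6 :
    ∃ (P : RAM.Program) (T : Polynomial ℕ),
      ∀ (n : ℕ) (M : ExchangeMarket (Fin n) (Fin n)),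
        M.AgentsUniform ∨ M.ItemsUniform →
          ∃ (m : RAM.Memory) (t : ℕ) (π : Fin n ≃ Fin n),
            RAM.Run P (RAM.initial M.encode) m t ∧
            t ≤ T.eval (RAM.inputLength M.encode) ∧
            RAM.Outputs m π ∧
            M.IsCoreStable π := by
  refine ⟨Hungarian.program.toProgram, Hungarian.program.timeBound, fun n M hM => ?_⟩
  have h00 : RAM.initial M.encode 0 0 = n := by
    simpa [RAM.initial] using M.getD_encode_zero
  have hz : ∀ k, k ≠ 0 → ∀ i, RAM.initial M.encode k i = 0 := fun k hk i => by
    simp [RAM.initial, hk]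
  have hwf : Hungarian.program.WellFormed := by
    simp [Hungarian.program, Hungarian.setup, Hungarian.rowBound, Hungarian.clearRow,
      Hungarian.phase, Hungarian.plant, Hungarian.growStep, Hungarian.scan, Hungarian.compare,
      Hungarian.record, Hungarian.shift,
      Hungarian.attach, Hungarian.augmentStep, RAM.LoopProgram.WellFormed, RAM.LoopProgram.writes]
  have h0 : 0 ∉ Hungarian.program.writes := by decide
  obtain ⟨t, ht, hrun⟩ := RAM.LoopProgram.exists_run hwf h0 h00
  obtain ⟨D, h5⟩ := Hungarian.den_program h00 hz
  obtain ⟨π, hπ, hopt⟩ := D.exists_optimal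
  refine ⟨_, t, π, hrun, ht.trans (Polynomial.eval_le_eval_nat _ M.le_inputLength_encode), hπ,
    M.isCoreStable_of_value_max hM π fun σ => ?_⟩
  have hw : ∀ i j : Fin n, Hungarian.weightAt
      (Hungarian.program.den n (RAM.initial M.encode)) (i : ℕ) (j : ℕ) = M.value i j := by
    intro i j
    rw [Hungarian.weightAt, h5 _ (by omega) (by omega), RAM.LoopProgram.den_frame _ _ _ h0,
      ← M.getD_encode_value i j, RAM.initial, if_pos ⟨rfl, by positivity⟩]
    congr 1
  simpa only [hw] using hopt σ
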